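/- Let $L^4$ be $\mathbb R^4$ with the scalar product $\langle X,Y\rangle=-X_0Y_0+X_1Y_1+X_2Y_2+X_3Y_3$, and let $H^3=\{X\in L^4:\langle X,X\rangle=-1,\ X_0>0\}$, $S^3_1=\{X\in L^4:\langle X,X\rangle=1\}$. Upper half-space models. $H^3$ is identified with $\mathbb R^3_+=\{x_3>0\}$ by $x=\frac{1}{X_0-X_3}(X_1,X_2,1)$, and each of the two parts $\{X_0-X_3<0\}$ and $\{X_0-X_3>0\}$ of $S_1^3$ by $x=\frac{1}{|X_0-X_3|}(X_1,X_2,1)$. $\mathbb R^3_+$ is a Lie group with product $a\cdot x=(a_1+a_3x_1,\,a_2+a_3x_2,\,a_3x_3)$ and identity $e=(0,0,1)$. For a smooth immersed surface in $H^3$ (resp. a smooth immersed space-like surface in $S^3_1$) with smooth unit normal field $N$, $\langle N,N\rangle=1$ (resp. $\langle N,N\rangle=-1$), the normal Gauss map $\widetilde N$ is obtained by expressing $N$ in the upper half-space model and left translating it to $T_e\mathbb R^3_+=\mathbb R^3$; in the case of $S_1^3$ it is defined on the set of points of the surface where $X_0\ne X_3$. The fourth fundamental form is $\mathrm{IV}=\langle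 d\widetilde N,d\widetilde N\rangle$, where $\mathbb R^3$ carries the Euclidean scalar product (resp. the scalar product $a_1b_1+a_2b_2-a_3b_3$). The second fundamental form is $\mathrm{II}=-\langle dX,dN\rangle$ (resp. $\mathrm{II}=\langle dX,dN\rangle$). The normal Gauss map is called conformal if $\mathrm{IV}=\rho\,\mathrm{II}$ for some smooth function $\rho$, on the set where the normal Gauss map is defined. A point is an umbilic if $\mathrm{II}$ is a multiple of $\mathrm I=\langle dX,dX\rangle$ there. $K$ denotes the Gauss curvature of the induced metric $\mathrm I$. The generalized Gauss map of a surface $X$ in $H^3$ (resp. of a space-like surface $X$ in $S_1^3$) is its unit normal field $N$, tangent to $H^3$ (resp. $S_1^3$), translated to the origin of $L^4$, that is, regarded as a map into $S^3_1$ (resp. into $H^3$). THEOREM 4.2. Let $M$ be a connected smooth $2$-dimensional manifold. Let $X:M\to H^3$ be a smooth immersed surface without umbilics and with Gauss curvature $K\neq-1$ everywhere, and let $N:M\to S^3_1$ be a smooth immersed space-like surface without umbilics and with Gauss curvature $K\neq1$ everywhere. Suppose that $N$ is the generalized Gauss map of $X$ and that $X$ is the generalized Gauss map of $N$. Then the normal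 Gauss map of $X:M\to H^3$ is conformal if and only if the normal Gauss map of $N:M\to S^3_1$ is conformal. In this case the volume elements (as densities) of the metrics induced by $N$ and $X$ satisfy $$dV_N=\left(\frac{N_0-N_3}{X_3-X_0}\right)^2dV_X .$$ -/

import Mathlib

open scoped Manifold ContDiff

namespace PolarDuality

noncomputable section

/-- The model space of a surface. -/
abbrev E2 : Type := EuclideanSpace ℝ (Fin 2)

/-- Minkowski 4-space, with coordinates `X 0, X 1, X 2, X 3`. -/
abbrev L4 : Type := Fin 4 → ℝ

/-- Three-space, the ambient space of the upper half-space models; also the tangent space of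
the half-space at the identity `(0, 0, 1)`. -/
abbrev R3 : Type := Fin 3 → ℝ

/-- The Lorentz-Minkowski scalar product of `L4`, of signature `(-, +, +, +)`. -/
def mink (X Y : L4) : ℝ := -(X 0 * Y 0) + X 1 * Y 1 + X 2 * Y 2 + X 3 * Y 3

/-- The Euclidean scalar product of three-space. -/
def euc3 (a b : R3) : ℝ := a 0 * b 0 + a 1 * b 1 + a 2 * b 2

/-- The Lorentz-Minkowski scalar product of three-space, of signature `(+, +, -)`. -/
def mink3 (a b : R3) : ℝ := a 0 * b 0 + a 1 * b 1 - a 2 * b 2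

/-- Hyperbolic 3-space in the Minkowski model. -/
def H3 : Set L4 := {X | mink X X = -1 ∧ 0 < X 0}

/-- De Sitter 3-space in the Minkowski model. -/
def dS3 : Set L4 := {X | mink X X = 1}

/-! ### The upper half-space models and the normal Gauss map -/

/-- The identification of `H3` (where `X 0 - X 3 > 0`) with the upper half-space. -/
def halfSpaceH (X : L4) : R3 :=
  ![X 1 / (X 0 - X 3), X 2 / (X 0 - X 3), 1 / (X 0 - X 3)]

/-- The identification of each of the two parts `X 0 - X 3 < 0` and `X 0 - X 3 > 0` of `dS3`
with the upper half-space. -/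
def halfSpaceS (X : L4) : R3 :=
  ![X 1 / |X 0 - X 3|, X 2 / |X 0 - X 3|, 1 / |X 0 - X 3|]

/-- The Lie group structure of the upper half-space `{x | 0 < x 2}`, as the group of the matrices
with rows `(1, 0, 0, log x₃)`, `(0, x₃, 0, x₁)`, `(0, 0, x₃, x₂)`, `(0, 0, 0, 1)`. -/
def grpMul (a x : R3) : R3 := ![a 0 + a 2 * x 0, a 1 + a 2 * x 1, a 2 * x 2]

/-- The inverse in the upper half-space group. -/
def grpInv (a : R3) : R3 := ![-a 0 / a 2, -a 1 / a 2, 1 / a 2]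

/-- The identity is `(0, 0, 1)`. -/
theorem grpMul_grpInv {a : R3} (ha : 0 < a 2) : grpMul (grpInv a) a = ![0, 0, 1] := by
  have h : a 2 ≠ 0 := ha.ne'
  ext i
  fin_cases i <;> simp [grpMul, grpInv] <;> field_simp <;> ring

/-- The left translate to the identity, by the inverse of the base point `x`, of the tangent
vector `v` at `x`. -/
def leftToId (x v : R3) : R3 := fderiv ℝ (grpMul (grpInv x)) x v

/-- The vector with coordinates `η` in the left-invariant frame `x₃ ∂/∂x_A` is translated to `η`. -/
theorem leftToId_eq (x v : R3) : leftToId x v = (1 / x 2) • v := by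
  have h : HasFDerivAt (grpMul (grpInv x))
      ((1 / x 2) • ContinuousLinearMap.id ℝ R3) x := by
    have e : grpMul (grpInv x) = fun y =>
        ((1 / x 2) • ContinuousLinearMap.id ℝ R3) y + ![-x 0 / x 2, -x 1 / x 2, 0] := by
      funext y
      ext i
      fin_cases i <;> simp [grpMul, grpInv] <;> ring
    rw [e]
    exact (ContinuousLinearMap.hasFDerivAt _).add_const _
  rw [leftToId, h.fderiv]
  simp

/-- With `Φ` the identification with the upper half-space, `X` a point and `N` a tangent vector
there in the Minkowski model: transport `N` to the upper half-space by the differential of `Φ`, and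
left translate it to the identity. -/
def gaussVec (Φ : L4 → R3) (X N : L4) : R3 := leftToId (Φ X) (fderiv ℝ Φ X N)

variable {M : Type*} [TopologicalSpace M] [ChartedSpace E2 M]

/-- The normal Gauss map of a surface `X` in `H3` with unit normal `N`. -/
def normalGaussH (X N : M → L4) (p : M) : R3 := gaussVec halfSpaceH (X p) (N p)

/-- The normal Gauss map of a space-like surface `X` in `dS3` with time-like unit normal `N`;
meaningful at the points with `X 0 ≠ X 3`, see `gaussDomain`. -/
def normalGaussS (X N : M → L4) (p : M) : R3 := gaussVec halfSpaceS (X p) (N p)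

/-- The set of points of the surface which `X` maps to one of the two parts of `dS3` that are
identified with the upper half-space. -/
def gaussDomain (X : M → L4) : Set M := {p | X p 0 - X p 3 < 0} ∪ {p | 0 < X p 0 - X p 3}

/-! ### Fundamental forms -/

/-- The differential of a map from the surface to a vector space. -/
def diff {F : Type*} [NormedAddCommGroup F] [NormedSpace ℝ F] (f : M → F) (p : M)
    (v : TangentSpace 𝓘(ℝ, E2) p) : F := mfderiv 𝓘(ℝ, E2) 𝓘(ℝ, F) f p v

/-- The first fundamental form `⟨dX, dX⟩`. -/
def formI (X : M → L4) (p : M) (v w : TangentSpace 𝓘(ℝ, E2) p) : ℝ :=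
  mink (diff X p v) (diff X p w)

/-- The second fundamental form `-⟨dX, dN⟩` of a surface `X` in `H3` with space-like unit
normal `N`. -/
def formIIH (X N : M → L4) (p : M) (v w : TangentSpace 𝓘(ℝ, E2) p) : ℝ :=
  -mink (diff X p v) (diff N p w)

/-- The second fundamental form of a space-like surface `X` in `dS3` with time-like unit
normal `N`: the coefficient of `N` in the ambient derivative, which is `⟨dX, dN⟩`
since `⟨N, N⟩ = -1`. -/
def formIIS (X N : M → L4) (p : M) (v w : TangentSpace 𝓘(ℝ, E2) p) : ℝ :=
  mink (diff X p v) (diff N p w)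

/-- The fourth fundamental form of a surface in `H3`. -/
def formIVH (X N : M → L4) (p : M) (v w : TangentSpace 𝓘(ℝ, E2) p) : ℝ :=
  euc3 (diff (normalGaussH X N) p v) (diff (normalGaussH X N) p w)

/-- The fourth fundamental form of a space-like surface in `dS3`. -/
def formIVS (X N : M → L4) (p : M) (v w : TangentSpace 𝓘(ℝ, E2) p) : ℝ :=
  mink3 (diff (normalGaussS X N) p v) (diff (normalGaussS X N) p w)

/-- The volume element of the induced metric, as a density: the area of the parallelogram spanned
by two tangent vectors. -/
def volElt (X : M → L4) (p : M) (v w : TangentSpace 𝓘(ℝ, E2) p) : ℝ :=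
  Real.sqrt (formI X p v v * formI X p w w - formI X p v w ^ 2)

/-! ### Surfaces, unit normals, umbilics -/

/-- `X` is a smooth immersed surface in `H3`. -/
structure IsSurfaceH (X : M → L4) : Prop where
  smooth : ContMDiff 𝓘(ℝ, E2) 𝓘(ℝ, L4) ∞ X
  mem : ∀ p, X p ∈ H3
  immersed : ∀ p, Function.Injective (mfderiv 𝓘(ℝ, E2) 𝓘(ℝ, L4) X p)

/-- `X` is a smooth immersed space-like surface in `dS3`. -/
structure IsSpacelikeSurfaceS (X : M → L4) : Prop where
  smooth : ContMDiff 𝓘(ℝ, E2) 𝓘(ℝ, L4) ∞ X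
  mem : ∀ p, X p ∈ dS3
  immersed : ∀ p, Function.Injective (mfderiv 𝓘(ℝ, E2) 𝓘(ℝ, L4) X p)
  spacelike : ∀ (p : M) (v : TangentSpace 𝓘(ℝ, E2) p), v ≠ 0 → 0 < formI X p v v

/-- `N` is the generalized Gauss map of the surface `X` in `H3`: a smooth space-like unit normal,
tangent to `H3` and normal to the surface, translated to the origin. -/
structure IsGenGaussMapH (X N : M → L4) : Prop where
  smooth : ContMDiff 𝓘(ℝ, E2) 𝓘(ℝ, L4) ∞ N
  unit : ∀ p, N p ∈ dS3
  tangent : ∀ p, mink (N p) (X p) = 0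
  normal : ∀ (p : M) (v : TangentSpace 𝓘(ℝ, E2) p), mink (N p) (diff X p v) = 0

/-- `N` is the generalized Gauss map of the space-like surface `X` in `dS3`: a smooth time-like
unit normal, tangent to `dS3` and normal to the surface, translated to the origin. -/
structure IsGenGaussMapS (X N : M → L4) : Prop where
  smooth : ContMDiff 𝓘(ℝ, E2) 𝓘(ℝ, L4) ∞ N
  unit : ∀ p, N p ∈ H3
  tangent : ∀ p, mink (N p) (X p) = 0
  normal : ∀ (p : M) (v : TangentSpace 𝓘(ℝ, E2) p), mink (N p) (diff X p v) = 0

/-- `p` is an umbilic of the surface `X` in `H3`. -/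
def IsUmbilicH (X N : M → L4) (p : M) : Prop :=
  ∃ c : ℝ, ∀ v w : TangentSpace 𝓘(ℝ, E2) p, formIIH X N p v w = c * formI X p v w

/-- `p` is an umbilic of the space-like surface `X` in `dS3`. -/
def IsUmbilicS (X N : M → L4) (p : M) : Prop :=
  ∃ c : ℝ, ∀ v w : TangentSpace 𝓘(ℝ, E2) p, formIIS X N p v w = c * formI X p v w

/-! ### Conformal normal Gauss maps -/

/-- The normal Gauss map of the surface `X` in `H3` is conformal: the fourth fundamental form is a
smooth function times the second one. -/
def ConformalGaussH (X N : M → L4) : Prop :=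
  ∃ ρ : M → ℝ, ContMDiff 𝓘(ℝ, E2) 𝓘(ℝ, ℝ) ∞ ρ ∧
    ∀ (p : M) (v w : TangentSpace 𝓘(ℝ, E2) p),
      formIVH X N p v w = ρ p * formIIH X N p v w

/-- The normal Gauss map of the space-like surface `X` in `dS3` is conformal: on the domain of that
map, the fourth fundamental form is a smooth function times the second one. -/
def ConformalGaussS (X N : M → L4) : Prop :=
  ∃ ρ : M → ℝ, ContMDiffOn 𝓘(ℝ, E2) 𝓘(ℝ, ℝ) ∞ ρ (gaussDomain X) ∧
    ∀ p ∈ gaussDomain X, ∀ v w : TangentSpace 𝓘(ℝ, E2) p,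
      formIVS X N p v w = ρ p * formIIS X N p v w

/-! ### Gauss curvature -/

/-- Partial derivative in a coordinate direction. -/
def pd (i : Fin 2) (f : E2 → ℝ) (u : E2) : ℝ := fderiv ℝ f u (EuclideanSpace.single i 1)

/-- Christoffel symbol `Γ^k_{ij}` of the metric `g` given by its matrix in coordinates. -/
def christoffel (g : E2 → Matrix (Fin 2) (Fin 2) ℝ) (k i j : Fin 2) (u : E2) : ℝ :=
  (1 / 2) * ∑ l, (g u)⁻¹ k l *
    (pd i (fun z => g z j l) u + pd j (fun z => g z i l) u - pd l (fun z => g z i j) u)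

/-- The `l`-th component of `R(∂₁, ∂₂)∂₂` for the Levi-Civita connection of `g`, where
`R(V, W) = ∇_V ∇_W - ∇_W ∇_V - ∇_[V, W]`. -/
def riem1222 (g : E2 → Matrix (Fin 2) (Fin 2) ℝ) (l : Fin 2) (u : E2) : ℝ :=
  pd 0 (christoffel g l 1 1) u - pd 1 (christoffel g l 0 1) u +
    ∑ k, (christoffel g k 1 1 u * christoffel g l 0 k u -
      christoffel g k 0 1 u * christoffel g l 1 k u)

/-- The Gauss curvature `⟨R(∂₁, ∂₂)∂₂, ∂₁⟩ / det g` of the metric `g`. -/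
def metricCurvature (g : E2 → Matrix (Fin 2) (Fin 2) ℝ) (u : E2) : ℝ :=
  (∑ l, riem1222 g l u * g u l 0) / (g u).det

/-- The coefficients of the metric induced by `X`, in the coordinates of the chart at `p`. -/
def chartMetric (X : M → L4) (p : M) (u : E2) : Matrix (Fin 2) (Fin 2) ℝ :=
  Matrix.of fun i j =>
    mink (fderiv ℝ (X ∘ (chartAt E2 p).symm) u (EuclideanSpace.single i 1))
      (fderiv ℝ (X ∘ (chartAt E2 p).symm) u (EuclideanSpace.single j 1))

/-- The (intrinsic) Gauss curvature at `p` of the metric induced by `X`. -/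
def gaussCurvature (X : M → L4) (p : M) : ℝ :=
  metricCurvature (chartMetric X p) (chartAt E2 p p)

end

end PolarDuality

namespace PolarDuality

/-! Put `r = (N 0 - N 3) / (X 0 - X 3)`. In half-space coordinates the normal Gauss map of `X` is
`(N 1 - r * X 1, N 2 - r * X 2, -r)`, and its differential gives `IV_X = ⟨dN - r dX, dN - r dX⟩`
(`formIVH_eq`). Exchanging the surfaces replaces `r` by `1 / r` (`formIVS_eq`), so `IV_X = r² IV_N`
where `N 0 ≠ N 3`, while `II_X = -II_N`. There the two conformality conditions agree.

It remains to exclude zeros of `N 0 - N 3`. Both `dX` and `dN` take values in the Euclidean plane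
orthogonal to `X` and `N`, so `dN = dX ∘ A`. Conformality reads `(A - r)² = -ρ A`, a monic quadratic
equation for `A`. Off umbilics `A` is not scalar, so this is its characteristic equation and `det A
= r²` (`gram_eq_of_conformal`). This is the volume formula; it also forces `r ≠ 0`, since `dN` is
injective.

If only the Gauss map of `N` is assumed conformal, the formula is known just where `N 0 ≠ N 3`. By
continuity a zero of `N 0 - N 3` would then be interior to the zero set, and a piece of `N` would
lie in a light-like hyperplane, where it cannot be space-like (`height_ne_zero_of_gram_eq`). -/

/-! ### Gram determinants and the quadratic equation of conformality. -/

theorem mink_comm (X Y : L4) : mink X Y = mink Y X := by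
  simp only [mink]; ring

theorem mink_add_smul_left (a b : ℝ) (X Y Z : L4) :
    mink (a • X + b • Y) Z = a * mink X Z + b * mink Y Z := by
  simp only [mink, Pi.add_apply, Pi.smul_apply, smul_eq_mul]; ring

theorem mink_add_smul_right (a b : ℝ) (X Y Z : L4) :
    mink Z (a • X + b • Y) = a * mink Z X + b * mink Z Y := by
  simp only [mink, Pi.add_apply, Pi.smul_apply, smul_eq_mul]; ring

/-- The Gram determinant of two vectors of Minkowski space. -/
def gram (x y : L4) : ℝ := mink x x * mink y y - mink x y ^ 2

theorem gram_comb (a b c d : ℝ) (x y : L4) :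
    gram (a • x + c • y) (b • x + d • y) = (a * d - b * c) ^ 2 * gram x y := by
  simp only [gram, mink_add_smul_left, mink_add_smul_right, mink_comm y x]; ring

theorem eq_smul_add_smul (v : E2) :
    v = v 0 • EuclideanSpace.single 0 1 + v 1 • EuclideanSpace.single 1 1 := by
  ext i; fin_cases i <;> simp

/-- A pair of orthonormal vectors `X` (time-like) and `N` (space-like) has a two-dimensional
orthogonal complement, so a linear map into it factors through an injective one. -/
theorem exists_factor {X N : L4} (hX : mink X X = -1) (hN : mink N N = 1) (hXN : mink N X = 0)
    (S T : E2 →L[ℝ] L4) (hS : Function.Injective S)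
    (hSX : ∀ v, mink X (S v) = 0) (hSN : ∀ v, mink N (S v) = 0)
    (hTX : ∀ v, mink X (T v) = 0) (hTN : ∀ v, mink N (T v) = 0) (v : E2) :
    ∃ w, T v = S w := by
  let φ : L4 →ₗ[ℝ] ℝ × ℝ :=
    { toFun := fun Y => (mink X Y, mink N Y)
      map_add' := fun Y Z => by ext <;> simp [mink] <;> ring
      map_smul' := fun c Y => by ext <;> simp [mink] <;> ring }
  have hφ : Function.Surjective φ := fun c => ⟨-c.1 • X + c.2 • N, by
    ext
    · change mink X _ = _
      rw [mink_add_smul_right, hX, mink_comm X N, hXN]; ring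
    · change mink N _ = _
      rw [mink_add_smul_right, hN, hXN]; ring⟩
  have hker : Module.finrank ℝ (LinearMap.ker φ) = 2 := by
    have h := φ.finrank_range_add_finrank_ker
    rw [LinearMap.range_eq_top.2 hφ] at h
    simp only [finrank_top, Module.finrank_prod, Module.finrank_self, Module.finrank_fin_fun] at h
    omega
  have hrange : Module.finrank ℝ (LinearMap.range (S : E2 →ₗ[ℝ] L4)) = 2 := by
    rw [LinearMap.finrank_range_of_inj hS]; simp
  have hle : LinearMap.range (S : E2 →ₗ[ℝ] L4) ≤ LinearMap.ker φ := by
    rintro _ ⟨w, rfl⟩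
    exact Prod.ext (hSX w) (hSN w)
  have heq := Submodule.eq_of_le_of_finrank_eq hle (hrange.trans hker.symm)
  have hT : T v ∈ LinearMap.range (S : E2 →ₗ[ℝ] L4) := by
    rw [heq]; exact Prod.ext (hTX v) (hTN v)
  obtain ⟨w, hw⟩ := hT
  exact ⟨w, hw.symm⟩

/-- Cramer's rule for the Gram matrix; it turns identities between scalar products into identities
between matrix entries. -/
theorem coeffs_eq_zero_of_mink {x y : L4} (h : gram x y ≠ 0) {s t : ℝ}
    (hx : mink x (s • x + t • y) = 0) (hy : mink y (s • x + t • y) = 0) : s = 0 ∧ t = 0 := by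
  rw [mink_add_smul_right] at hx hy
  rw [mink_comm y x] at hy
  constructor
  · apply (mul_eq_zero.1 (?_ : s * gram x y = 0)).resolve_right h
    rw [gram]; linear_combination mink y y * hx - mink x y * hy
  · apply (mul_eq_zero.1 (?_ : t * gram x y = 0)).resolve_right h
    rw [gram]; linear_combination mink x x * hy - mink x y * hx

theorem gram_pos {S : E2 →L[ℝ] L4} (hg : ∀ v, v ≠ 0 → 0 < mink (S v) (S v)) :
    0 < gram (S (EuclideanSpace.single 0 1)) (S (EuclideanSpace.single 1 1)) := by
  set x := S (EuclideanSpace.single 0 1) with hx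
  set y := S (EuclideanSpace.single 1 1) with hy
  have hxx : 0 < mink x x := hg _ (by simp)
  -- Gram–Schmidt without division: `⟨x, x⟩ y - ⟨x, y⟩ x` has square `⟨x, x⟩ * gram x y`.
  have h := hg (-mink x y • EuclideanSpace.single 0 1 + mink x x • EuclideanSpace.single 1 1)
    fun h => hxx.ne' (by simpa using congrArg (fun z : E2 => z 1) h)
  rw [map_add, map_smul, map_smul, ← hx, ← hy, mink_add_smul_left, mink_add_smul_right,
    mink_add_smul_right, mink_comm y x] at h
  have h' : 0 < mink x x * gram x y := by
    rw [gram]; linarith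
  exact (mul_pos_iff_of_pos_left hxx).1 h'

/-- If `T` is not a multiple of `S` and `⟨(T - r S) v, (T - r S) w⟩ = -ρ ⟨S v, T w⟩`, then the
Gram determinants of `T` and `S` differ by the factor `r ^ 4`. -/
theorem gram_eq_of_conformal {X N : L4} (hX : mink X X = -1) (hN : mink N N = 1)
    (hXN : mink N X = 0) (S T : E2 →L[ℝ] L4) (hS : Function.Injective S)
    (hSX : ∀ v, mink X (S v) = 0) (hSN : ∀ v, mink N (S v) = 0)
    (hTX : ∀ v, mink X (T v) = 0) (hTN : ∀ v, mink N (T v) = 0)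
    (hg : ∀ v, v ≠ 0 → 0 < mink (S v) (S v))
    (hu : ¬ ∃ c : ℝ, ∀ v w, -mink (S v) (T w) = c * mink (S v) (S w)) {r ρ : ℝ}
    (hc : ∀ v w, mink (T v - r • S v) (T w - r • S w) = ρ * -mink (S v) (T w)) (v w : E2) :
    gram (T v) (T w) = r ^ 4 * gram (S v) (S w) := by
  set x := S (EuclideanSpace.single 0 1) with hx
  set y := S (EuclideanSpace.single 1 1) with hy
  have hSv : ∀ v, S v = v 0 • x + v 1 • y := fun v => by
    conv_lhs => rw [eq_smul_add_smul v]
    simp [hx, hy]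
  have hG : 0 < gram x y := gram_pos hg
  have hfac := exists_factor hX hN hXN S T hS hSX hSN hTX hTN
  obtain ⟨w₀, h₀⟩ := hfac (EuclideanSpace.single 0 1)
  obtain ⟨w₁, h₁⟩ := hfac (EuclideanSpace.single 1 1)
  rw [hSv] at h₀ h₁
  generalize w₀ 0 = a, w₀ 1 = c at h₀
  generalize w₁ 0 = b, w₁ 1 = d at h₁
  have hTv : ∀ v, T v = v 0 • (a • x + c • y) + v 1 • (b • x + d • y) := fun v => by
    conv_lhs => rw [eq_smul_add_smul v]
    simp [h₀, h₁]
  have hsub : ∀ v, T v - r • S v =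
      ((a - r) * v 0 + b * v 1) • x + (c * v 0 + (d - r) * v 1) • y := fun v => by
    rw [hTv, hSv]; module
  have hnscal : ¬ (b = 0 ∧ c = 0 ∧ a = d) := by
    rintro ⟨rfl, rfl, rfl⟩
    refine hu ⟨-a, fun v w => ?_⟩
    have : T w = a • S w := by rw [hTv, hSv]; module
    rw [this]
    simp only [mink, Pi.smul_apply, smul_eq_mul]; ring
  -- For `ρ = 0`, definiteness on the range of `S` would give `T = r • S`, an umbilic.
  have hρ : ρ ≠ 0 := by
    rintro rfl
    have hz : ∀ v, T v = r • S v := fun v => by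
      obtain ⟨w, hw⟩ := hfac v
      have h := hc v v
      rw [hw, ← map_smul, ← map_sub, zero_mul] at h
      by_contra hne
      rw [hw, ← map_smul] at hne
      exact (hg (w - r • v) fun h0 => hne (congrArg S (sub_eq_zero.1 h0))).ne' h
    refine hu ⟨-r, fun v w => ?_⟩
    rw [hz]
    simp only [mink, Pi.smul_apply, smul_eq_mul]; ring
  have c00 := hc (EuclideanSpace.single 0 1) (EuclideanSpace.single 0 1)
  have c01 := hc (EuclideanSpace.single 0 1) (EuclideanSpace.single 1 1)
  have c10 := hc (EuclideanSpace.single 1 1) (EuclideanSpace.single 0 1)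
  have c11 := hc (EuclideanSpace.single 1 1) (EuclideanSpace.single 1 1)
  simp only [hsub] at c00 c01 c10 c11
  simp only [h₀, h₁, ← hx, ← hy, mink_add_smul_left, mink_add_smul_right, mink_comm y x,
    PiLp.single_apply, ↓reduceIte, one_ne_zero, zero_ne_one, mul_one, mul_zero, add_zero,
    zero_add] at c00 c01 c10 c11
  -- Self-adjointness of `A`, with columns `(a, c)` and `(b, d)`. No second derivatives are needed:
  -- the left side of `hc` is symmetric and `ρ ≠ 0`.
  have hsym : b * mink x x + d * mink x y = a * mink x y + c * mink y y := by
    apply mul_left_cancel₀ hρ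
    linear_combination c01 - c10
  -- `p1` to `p4` are the entries of `A² + (ρ - 2r) A + r² = 0`.
  obtain ⟨p1, p2⟩ := coeffs_eq_zero_of_mink hG.ne'
    (s := a ^ 2 + b * c + (ρ - 2 * r) * a + r ^ 2) (t := c * (a + d + ρ - 2 * r))
    (by rw [mink_add_smul_right]; linear_combination c00 + c * hsym)
    (by rw [mink_add_smul_right, mink_comm y x]; linear_combination c10 + (r - a) * hsym)
  obtain ⟨p3, p4⟩ := coeffs_eq_zero_of_mink hG.ne'
    (s := b * (a + d + ρ - 2 * r)) (t := d ^ 2 + b * c + (ρ - 2 * r) * d + r ^ 2)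
    (by rw [mink_add_smul_right]; linear_combination c01 + (d - r) * hsym)
    (by rw [mink_add_smul_right, mink_comm y x]; linear_combination c11 - b * hsym)
  -- Either the trace is `2r - ρ`, and comparison with Cayley–Hamilton gives the determinant, or `A`
  -- is scalar.
  have hdet : a * d - b * c = r ^ 2 := by
    by_cases ht : a + d + ρ - 2 * r = 0
    · linear_combination a * ht - p1
    · have hb := (mul_eq_zero.1 p3).resolve_right ht
      have hc' := (mul_eq_zero.1 p2).resolve_right ht
      refine absurd ⟨hb, hc', ?_⟩ hnscal
      have : (a - d) * (a + d + ρ - 2 * r) = 0 := by linear_combination p1 - p4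
      exact sub_eq_zero.1 ((mul_eq_zero.1 this).resolve_right ht)
  have hTg : gram (T v) (T w) =
      (v 0 * w 1 - w 0 * v 1) ^ 2 * gram (a • x + c • y) (b • x + d • y) := by
    rw [hTv, hTv, gram_comb]
  rw [hTg, hSv v, hSv w, gram_comb, gram_comb, hdet]; ring

/-! ### Orthogonality in Minkowski space. -/

/-- Vectors orthogonal to a point of hyperbolic space are space-like. -/
theorem mink_self_pos {X W : L4} (hX : mink X X = -1) (hW : mink X W = 0) (h : W ≠ 0) :
    0 < mink W W := by
  simp only [mink] at *
  have hne : 0 < W 1 ^ 2 + W 2 ^ 2 + W 3 ^ 2 := by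
    by_contra hle
    have h1 : W 1 = 0 := by nlinarith [sq_nonneg (W 1), sq_nonneg (W 2), sq_nonneg (W 3)]
    have h2 : W 2 = 0 := by nlinarith [sq_nonneg (W 1), sq_nonneg (W 2), sq_nonneg (W 3)]
    have h3 : W 3 = 0 := by nlinarith [sq_nonneg (W 1), sq_nonneg (W 2), sq_nonneg (W 3)]
    have h0 : W 0 = 0 := by
      rw [h1, h2, h3] at hW
      have hX0 : X 0 ≠ 0 := by
        intro h0
        rw [h0] at hX
        nlinarith [sq_nonneg (X 1), sq_nonneg (X 2), sq_nonneg (X 3)]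
      exact (mul_eq_zero.1 (by linarith : X 0 * W 0 = 0)).resolve_left hX0
    exact h (by ext i; fin_cases i <;> assumption)
  have hX0 : 0 < X 0 ^ 2 := by nlinarith [sq_nonneg (X 1), sq_nonneg (X 2), sq_nonneg (X 3)]
  have key : 0 < X 0 ^ 2 * (W 1 ^ 2 + W 2 ^ 2 + W 3 ^ 2 - W 0 ^ 2) := by
    -- With spatial parts `x`, `w`: `X 0 ^ 2 = 1 + |x|²` and `X 0 * W 0 = x · w`, so Lagrange's
    -- identity leaves `|w|² + |x × w|²`.
    have e : X 0 ^ 2 * (W 1 ^ 2 + W 2 ^ 2 + W 3 ^ 2 - W 0 ^ 2) = (W 1 ^ 2 + W 2 ^ 2 + W 3 ^ 2) +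
        ((X 1 * W 2 - X 2 * W 1) ^ 2 + (X 1 * W 3 - X 3 * W 1) ^ 2 +
          (X 2 * W 3 - X 3 * W 2) ^ 2) := by
      linear_combination (-(W 1 ^ 2 + W 2 ^ 2 + W 3 ^ 2)) * hX +
        (X 0 * W 0 + X 1 * W 1 + X 2 * W 2 + X 3 * W 3) * hW
    rw [e]; positivity
  have := (mul_pos_iff_of_pos_left hX0).1 key
  linarith

/-- The scalar product of two vectors orthogonal to `X`, in terms of their components in the upper
half-space model. -/
theorem mink_eq_of_orthogonal {X W W' : L4} {ε τ τ' : ℝ} (hX : mink X X = -ε)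
    (hW : mink X W = 0) (hW' : mink X W' = 0) (hτ : W 0 - W 3 = (X 0 - X 3) * τ)
    (hτ' : W' 0 - W' 3 = (X 0 - X 3) * τ') :
    (W 1 - X 1 * τ) * (W' 1 - X 1 * τ') + (W 2 - X 2 * τ) * (W' 2 - X 2 * τ') + ε * (τ * τ') =
      mink W W' := by
  -- `W - τ X` and `W' - τ' X` lie in the hyperplane `Y 0 = Y 3`, where only coordinates 1 and 2
  -- contribute; by orthogonality to `X` their product is `⟨W, W'⟩ - ε τ τ'`.
  simp only [mink] at *
  obtain rfl : ε = X 0 * X 0 - X 1 * X 1 - X 2 * X 2 - X 3 * X 3 := by linarith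
  have h0 : W 0 = W 3 + (X 0 - X 3) * τ := by linarith
  have h0' : W' 0 = W' 3 + (X 0 - X 3) * τ' := by linarith
  rw [h0] at hW ⊢
  rw [h0'] at hW' ⊢
  linear_combination -τ' * hW - τ * hW'

/-! ### Differentials in charts. -/

variable {M : Type*} [TopologicalSpace M] [ChartedSpace E2 M]

/-- The differential at `p` can be computed in the chart at `p`. -/
theorem diff_eq_of_hasFDerivAt {F : Type*} [NormedAddCommGroup F] [NormedSpace ℝ F] {f : M → F}
    {p : M} {f' : E2 →L[ℝ] F}
    (h : HasFDerivAt (f ∘ (chartAt E2 p).symm) f' (chartAt E2 p p)) (v : E2) :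
    diff f p v = f' v := by
  have hc : ContinuousAt f p := by
    have h1 : ContinuousAt ((f ∘ (chartAt E2 p).symm) ∘ chartAt E2 p) p :=
      ContinuousAt.comp h.continuousAt
        ((chartAt E2 p).continuousAt (mem_chart_source E2 p))
    refine h1.congr ?_
    filter_upwards [(chartAt E2 p).open_source.mem_nhds (mem_chart_source E2 p)] with q hq
    simp [(chartAt E2 p).left_inv hq]
  have hm : HasMFDerivAt 𝓘(ℝ, E2) 𝓘(ℝ, F) f p f' := by
    refine ⟨hc, ?_⟩
    exact h.hasFDerivWithinAt
  exact congrArg (fun L : E2 →L[ℝ] F => L v) hm.mfderiv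

/-- The differential as a continuous linear map on the model space. -/
noncomputable def diffL {F : Type*} [NormedAddCommGroup F] [NormedSpace ℝ F] (f : M → F) (p : M) : E2 →L[ℝ] F :=
  mfderiv 𝓘(ℝ, E2) 𝓘(ℝ, F) f p

theorem diff_eq_diffL {F : Type*} [NormedAddCommGroup F] [NormedSpace ℝ F] (f : M → F) (p : M)
    (v : E2) : diff f p v = diffL f p v := rfl

theorem hasFDerivAt_chart {F : Type*} [NormedAddCommGroup F] [NormedSpace ℝ F] {f : M → F}
    (hf : ContMDiff 𝓘(ℝ, E2) 𝓘(ℝ, F) ∞ f) (p : M) :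
    HasFDerivAt (f ∘ (chartAt E2 p).symm) (diffL f p) (chartAt E2 p p) := by
  have h := ((hf p).mdifferentiableAt (by simp)).hasMFDerivAt.2
  rw [modelWithCornersSelf_coe, Set.range_id] at h
  exact hasFDerivWithinAt_univ.1 h

theorem contDiffOn_chart [IsManifold 𝓘(ℝ, E2) ∞ M] {F : Type*} [NormedAddCommGroup F]
    [NormedSpace ℝ F] {f : M → F}
    (hf : ContMDiff 𝓘(ℝ, E2) 𝓘(ℝ, F) ∞ f) (p : M) :
    ContDiffOn ℝ ∞ (f ∘ (chartAt E2 p).symm) (chartAt E2 p).target := by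
  rw [← contMDiffOn_iff_contDiffOn]
  exact hf.comp_contMDiffOn contMDiffOn_chart_symm

/-- The vector at a point of the chart domain with coordinates `e` in the chart at `p`. -/
noncomputable def chartVec (p : M) (u e : E2) : E2 :=
  mfderiv 𝓘(ℝ, E2) 𝓘(ℝ, E2) (chartAt E2 p).symm u e

theorem fderiv_chart [IsManifold 𝓘(ℝ, E2) ∞ M] {F : Type*} [NormedAddCommGroup F]
    [NormedSpace ℝ F] {f : M → F}
    (hf : ContMDiff 𝓘(ℝ, E2) 𝓘(ℝ, F) ∞ f) (p : M) {u : E2}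
    (hu : u ∈ (chartAt E2 p).target) (e : E2) :
    fderiv ℝ (f ∘ (chartAt E2 p).symm) u e =
      diffL f ((chartAt E2 p).symm u) (chartVec p u e) := by
  rw [← mfderiv_eq_fderiv, mfderiv_comp u ((hf _).mdifferentiableAt (by simp))
    (((contMDiffOn_chart_symm (n := ∞)).contMDiffAt
      ((chartAt E2 p).open_target.mem_nhds hu)).mdifferentiableAt (by simp))]
  rfl

/-! ### The normal Gauss map and its differential. -/

theorem hasFDerivAt_coord (i : Fin 4) (X : L4) :
    HasFDerivAt (fun Y : L4 => Y i) (ContinuousLinearMap.proj (R := ℝ) (φ := fun _ => ℝ) i) X :=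
  (ContinuousLinearMap.proj (R := ℝ) (φ := fun _ : Fin 4 => ℝ) i).hasFDerivAt

theorem hasFDerivAt_vec3 {E : Type*} [NormedAddCommGroup E] [NormedSpace ℝ E] {f g h : E → ℝ}
    {f' g' h' : E →L[ℝ] ℝ} {x : E} (hf : HasFDerivAt f f' x) (hg : HasFDerivAt g g' x)
    (hh : HasFDerivAt h h' x) :
    HasFDerivAt (fun y => (![f y, g y, h y] : R3))
      (ContinuousLinearMap.pi (![f', g', h'] : Fin 3 → E →L[ℝ] ℝ)) x :=
  hasFDerivAt_pi'.2 fun i => by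
    fin_cases i
    exacts [hf, hg, hh]

theorem hasFDerivAt_quotient {E : Type*} [NormedAddCommGroup E] [NormedSpace ℝ E] {f g : E → ℝ}
    {f' g' : E →L[ℝ] ℝ} {x : E} (hf : HasFDerivAt f f' x) (hg : HasFDerivAt g g' x)
    (h : g x ≠ 0) :
    HasFDerivAt (fun y => f y / g y) ((1 / g x) • (f' - (f x / g x) • g')) x := by
  have hi := (hasDerivAt_inv h).comp_hasFDerivAt x hg
  have hm := hf.mul hi
  refine (hm.congr_fderiv ?_).congr_of_eventuallyEq (Filter.Eventually.of_forall fun y => ?_)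
  · ext v
    simp
    field_simp
    ring
  · simp [div_eq_mul_inv]

theorem gaussVec_halfSpaceH {X N : L4} (h : X 0 - X 3 ≠ 0) :
    gaussVec halfSpaceH X N = ![N 1 - (N 0 - N 3) / (X 0 - X 3) * X 1,
      N 2 - (N 0 - N 3) / (X 0 - X 3) * X 2, -((N 0 - N 3) / (X 0 - X 3))] := by
  have hf := (hasFDerivAt_coord 0 X).sub (hasFDerivAt_coord 3 X)
  have h1 := hasFDerivAt_quotient (hasFDerivAt_coord 1 X) hf h
  have h2 := hasFDerivAt_quotient (hasFDerivAt_coord 2 X) hf h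
  have h3 := hasFDerivAt_quotient (hasFDerivAt_const (1 : ℝ) X) hf h
  have hΦ : HasFDerivAt halfSpaceH _ X := hasFDerivAt_vec3 h1 h2 h3
  rw [gaussVec, leftToId_eq, hΦ.fderiv]
  ext i
  fin_cases i <;> simp [halfSpaceH] <;> field_simp

/-- Where `X 0 < X 3` the two models differ by a sign, which cancels because left translation
divides by the third coordinate. -/
theorem gaussVec_halfSpaceS {X N : L4} (h : X 0 - X 3 ≠ 0) :
    gaussVec halfSpaceS X N = gaussVec halfSpaceH X N := by
  have hcont : Continuous fun Y : L4 => Y 0 - Y 3 := by fun_prop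
  rcases lt_or_gt_of_ne h with h | h
  · have key : halfSpaceS =ᶠ[nhds X] -halfSpaceH := by
      filter_upwards [hcont.continuousAt.eventually_lt_const h] with Y hY
      ext i
      fin_cases i <;> simp [halfSpaceS, halfSpaceH, abs_of_neg hY, -neg_sub, div_neg]
    rw [gaussVec, gaussVec, key.fderiv_eq, key.eq_of_nhds, fderiv_neg, leftToId_eq, leftToId_eq]
    simp [inv_neg]
  · have key : halfSpaceS =ᶠ[nhds X] halfSpaceH := by
      filter_upwards [hcont.continuousAt.eventually_const_lt h] with Y hY
      ext i
      fin_cases i <;> simp [halfSpaceS, halfSpaceH, abs_of_pos hY]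
    rw [gaussVec, gaussVec, key.fderiv_eq, key.eq_of_nhds]

/-- Product rule for `(B 1 - r * A 1, B 2 - r * A 2, -r)`; `τ` is the derivative along `v` of the
quotient whose value at `p` is `r`. It serves both surfaces, with `A` and `B` exchanged. -/
theorem diff_gaussVec {A B : M → L4} {η : M → R3} (hA : ContMDiff 𝓘(ℝ, E2) 𝓘(ℝ, L4) ∞ A)
    (hB : ContMDiff 𝓘(ℝ, E2) 𝓘(ℝ, L4) ∞ B) {p : M} (h : A p 0 - A p 3 ≠ 0)
    (hη : η =ᶠ[nhds p] fun q => gaussVec halfSpaceH (A q) (B q))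
    (v : E2) {r τ : ℝ} (hr : B p 0 - B p 3 = r * (A p 0 - A p 3))
    (hτ : diff B p v 0 - diff B p v 3 =
      r * (diff A p v 0 - diff A p v 3) + (A p 0 - A p 3) * τ) :
    diff η p v = ![diff B p v 1 - r * diff A p v 1 - A p 1 * τ,
      diff B p v 2 - r * diff A p v 2 - A p 2 * τ, -τ] := by
  set u := chartAt E2 p p with hu
  have hpu : (chartAt E2 p).symm u = p := (chartAt E2 p).left_inv (mem_chart_source E2 p)
  have hsymm : ContinuousAt (chartAt E2 p).symm u :=
    (chartAt E2 p).continuousAt_symm (mem_chart_target E2 p)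
  have hYd := hasFDerivAt_chart hA p
  have hZd := hasFDerivAt_chart hB p
  rw [← hu] at hYd hZd
  set Y : E2 → L4 := A ∘ (chartAt E2 p).symm with hY
  set Z : E2 → L4 := B ∘ (chartAt E2 p).symm with hZ
  have hYu : Y u = A p := congrArg A hpu
  have hZu : Z u = B p := congrArg B hpu
  have hYi := fun i => (hasFDerivAt_pi'.1 hYd) i
  have hZi := fun i => (hasFDerivAt_pi'.1 hZd) i
  have ht := hasFDerivAt_quotient ((hZi 0).sub (hZi 3)) ((hYi 0).sub (hYi 3))
    (by simpa [hYu] using h)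
  have h1 := (hZi 1).sub (ht.mul (hYi 1))
  have h2 := (hZi 2).sub (ht.mul (hYi 2))
  have h3 := ht.neg
  have hne : ∀ᶠ w in nhds u, Y w 0 - Y w 3 ≠ 0 := by
    have hc : ContinuousAt (fun w => Y w 0 - Y w 3) u :=
      ((hYi 0).continuousAt).sub ((hYi 3).continuousAt)
    exact hc.eventually_ne (by rwa [hYu])
  have hev : ∀ᶠ w in nhds u, (η ∘ (chartAt E2 p).symm) w = gaussVec halfSpaceH (Y w) (Z w) := by
    have h0 : Filter.Tendsto (chartAt E2 p).symm (nhds u) (nhds p) := by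
      simpa [ContinuousAt, hpu] using hsymm
    exact h0.eventually hη
  have hd := (hasFDerivAt_vec3 h1 h2 h3).congr_of_eventuallyEq (f₁ := η ∘ (chartAt E2 p).symm) (by
    filter_upwards [hev, hne] with w hw hw'
    rw [hw, gaussVec_halfSpaceH hw']
    rfl)
  have hrr : (B p 0 - B p 3) / (A p 0 - A p 3) = r := by rw [hr]; field_simp
  have hττ : (1 / (A p 0 - A p 3)) * ((diff B p v 0 - diff B p v 3) -
      r * (diff A p v 0 - diff A p v 3)) = τ := by rw [hτ]; field_simp; ring
  simp only [diff_eq_diffL] at hττ ⊢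
  refine (diff_eq_of_hasFDerivAt hd v).trans ?_
  ext i
  fin_cases i
  · simp [hYu, hZu, hrr, ← hττ]; ring
  · simp [hYu, hZu, hrr, ← hττ]; ring
  · simp [hYu, hZu, hrr, ← hττ]

/-- On the light-like hyperplane `Y 0 = Y 3` the product has rank 2, and the unit vector `N` uses up
one dimension, so at most rank 1 is left on its complement. -/
theorem gram_eq_zero_of_null {N W W' : L4} (hN : mink N N = 1) (h : N 0 = N 3)
    (hW : mink N W = 0) (hW' : mink N W' = 0) (h0 : W 0 = W 3) (h0' : W' 0 = W' 3) :
    gram W W' = 0 := by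
  simp only [gram, mink] at *
  rw [h] at hN hW hW'
  rw [h0] at hW ⊢
  rw [h0'] at hW' ⊢
  have e1 : (W 1 * W' 2 - W 2 * W' 1) * N 1 = 0 := by
    linear_combination W' 2 * hW - W 2 * hW'
  have e2 : (W 1 * W' 2 - W 2 * W' 1) * N 2 = 0 := by
    linear_combination W 1 * hW' - W' 1 * hW
  have e : W 1 * W' 2 - W 2 * W' 1 = 0 := by
    linear_combination -(W 1 * W' 2 - W 2 * W' 1) * hN + N 1 * e1 + N 2 * e2
  linear_combination (W 1 * W' 2 - W 2 * W' 1) * e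

/-- `(X 0 - X 3) * (X 0 + X 3) = 1 + X 1 ^ 2 + X 2 ^ 2`, and the two factors have positive sum. -/
theorem sub_pos_of_mem_H3 {X : L4} (h : X ∈ H3) : 0 < X 0 - X 3 := by
  obtain ⟨h1, h2⟩ := h
  simp only [mink] at h1
  nlinarith [sq_nonneg (X 1), sq_nonneg (X 2)]

variable {X N : M → L4}

theorem mink_diffL_self {F : M → L4} (hF : ContMDiff 𝓘(ℝ, E2) 𝓘(ℝ, L4) ∞ F) {c : ℝ}
    (h : ∀ p, mink (F p) (F p) = c) (p : M) (v : E2) : mink (F p) (diffL F p v) = 0 := by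
  have hd := hasFDerivAt_chart hF p
  have hpu : (chartAt E2 p).symm (chartAt E2 p p) = p :=
    (chartAt E2 p).left_inv (mem_chart_source E2 p)
  have hi := fun i => (hasFDerivAt_pi'.1 hd) i
  have hm := (((((hi 0).mul (hi 0)).neg).add ((hi 1).mul (hi 1))).add
    ((hi 2).mul (hi 2))).add ((hi 3).mul (hi 3))
  have hc : HasFDerivAt _ (0 : E2 →L[ℝ] ℝ) (chartAt E2 p p) := hasFDerivAt_const c _
  have he := hm.unique (hc.congr_of_eventuallyEq (Filter.Eventually.of_forall fun u =>
    h ((chartAt E2 p).symm u)))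
  have hv := congrArg (fun L : E2 →L[ℝ] ℝ => L v) he
  simp [hpu] at hv
  simp only [mink]
  linarith

/-! ### Polar pairs: comparison of the forms and conclusion. -/

/-- A surface in hyperbolic space and its polar dual surface in de Sitter space. -/
structure IsPolarPair (X N : M → L4) : Prop where
  smoothX : ContMDiff 𝓘(ℝ, E2) 𝓘(ℝ, L4) ∞ X
  smoothN : ContMDiff 𝓘(ℝ, E2) 𝓘(ℝ, L4) ∞ N
  mem : ∀ p, X p ∈ H3
  unit : ∀ p, mink (N p) (N p) = 1
  orth : ∀ p, mink (N p) (X p) = 0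
  injX : ∀ p, Function.Injective (diffL X p)
  normalX : ∀ p v, mink (N p) (diffL X p v) = 0
  normalN : ∀ p v, mink (X p) (diffL N p v) = 0
  posN : ∀ (p : M) (v : E2), v ≠ 0 → 0 < mink (diffL N p v) (diffL N p v)

namespace IsPolarPair

theorem height_pos (h : IsPolarPair X N) (p : M) : 0 < X p 0 - X p 3 := sub_pos_of_mem_H3 (h.mem p)

theorem tangentX (h : IsPolarPair X N) (p : M) (v : E2) : mink (X p) (diffL X p v) = 0 :=
  mink_diffL_self h.smoothX (fun q => (h.mem q).1) p v

theorem tangentN (h : IsPolarPair X N) (p : M) (v : E2) : mink (N p) (diffL N p v) = 0 :=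
  mink_diffL_self h.smoothN h.unit p v

theorem posX (h : IsPolarPair X N) (p : M) (v : E2) (hv : v ≠ 0) :
    0 < mink (diffL X p v) (diffL X p v) :=
  mink_self_pos (h.mem p).1 (h.tangentX p v) fun h0 =>
    hv (h.injX p (h0.trans (map_zero _).symm))

/-- `dN - r dX` is orthogonal to `X`, and the differential of the normal Gauss map consists of its
half-space components, so `mink_eq_of_orthogonal` applies with `ε = 1`. -/
theorem formIVH_eq (h : IsPolarPair X N) {p : M} {r : ℝ}
    (hr : N p 0 - N p 3 = r * (X p 0 - X p 3)) (v w : E2) :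
    formIVH X N p v w =
      mink (diffL N p v - r • diffL X p v) (diffL N p w - r • diffL X p w) := by
  have hf := (h.height_pos p).ne'
  have hτ : ∀ v : E2, ∃ τ : ℝ, diffL N p v 0 - diffL N p v 3 =
      r * (diffL X p v 0 - diffL X p v 3) + (X p 0 - X p 3) * τ := fun v =>
    ⟨(diffL N p v 0 - diffL N p v 3 - r * (diffL X p v 0 - diffL X p v 3)) / (X p 0 - X p 3), by
      field_simp; ring⟩
  have hW : ∀ v, mink (X p) (diffL N p v - r • diffL X p v) = 0 := fun v => by
    have := mink_add_smul_right 1 (-r) (diffL N p v) (diffL X p v) (X p)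
    rw [h.normalN, h.tangentX, one_smul, neg_smul, ← sub_eq_add_neg] at this
    rw [this]; ring
  obtain ⟨τ, ht⟩ := hτ v
  obtain ⟨τ', ht'⟩ := hτ w
  have hη : ∀ (v : E2) {τ : ℝ}, _ → diff (normalGaussH X N) p v = _ := fun v τ =>
    diff_gaussVec h.smoothX h.smoothN hf (Filter.EventuallyEq.refl _ _) v (τ := τ) hr
  refine (congrArg₂ euc3 (hη v ht) (hη w ht')).trans ?_
  rw [← mink_eq_of_orthogonal (h.mem p).1 (hW v) (hW w) (τ := τ)
    (τ' := τ') (by simp only [Pi.sub_apply, Pi.smul_apply, smul_eq_mul]; linarith)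
    (by simp only [Pi.sub_apply, Pi.smul_apply, smul_eq_mul]; linarith)]
  simp [euc3, diff_eq_diffL]

/-- Here the base point is space-like, so `ε = -1`, which produces the minus sign of `mink3`. -/
theorem formIVS_eq (h : IsPolarPair X N) {p : M} {q : ℝ} (hg : N p 0 - N p 3 ≠ 0)
    (hq : X p 0 - X p 3 = q * (N p 0 - N p 3)) (v w : E2) :
    formIVS N X p v w =
      mink (diffL X p v - q • diffL N p v) (diffL X p w - q • diffL N p w) := by
  have hτ : ∀ v : E2, ∃ τ : ℝ, diffL X p v 0 - diffL X p v 3 =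
      q * (diffL N p v 0 - diffL N p v 3) + (N p 0 - N p 3) * τ := fun v =>
    ⟨(diffL X p v 0 - diffL X p v 3 - q * (diffL N p v 0 - diffL N p v 3)) / (N p 0 - N p 3), by
      field_simp; ring⟩
  have hW : ∀ v, mink (N p) (diffL X p v - q • diffL N p v) = 0 := fun v => by
    have := mink_add_smul_right 1 (-q) (diffL X p v) (diffL N p v) (N p)
    rw [h.normalX, h.tangentN, one_smul, neg_smul, ← sub_eq_add_neg] at this
    rw [this]; ring
  obtain ⟨τ, ht⟩ := hτ v
  obtain ⟨τ', ht'⟩ := hτ w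
  have hev : normalGaussS N X =ᶠ[nhds p] fun q => gaussVec halfSpaceH (N q) (X q) := by
    have hc : Continuous fun q => N q 0 - N q 3 := by
      have := h.smoothN.continuous
      fun_prop
    filter_upwards [hc.continuousAt.eventually_ne hg] with q hq
    exact gaussVec_halfSpaceS hq
  have hη : ∀ (v : E2) {τ : ℝ}, _ → diff (normalGaussS N X) p v = _ := fun v τ =>
    diff_gaussVec h.smoothN h.smoothX hg hev v (τ := τ) hq
  refine (congrArg₂ mink3 (hη v ht) (hη w ht')).trans ?_
  rw [← mink_eq_of_orthogonal (ε := -1) (by simp [h.unit p]) (hW v)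
    (hW w) (τ := τ) (τ' := τ')
    (by simp only [Pi.sub_apply, Pi.smul_apply, smul_eq_mul]; linarith)
    (by simp only [Pi.sub_apply, Pi.smul_apply, smul_eq_mul]; linarith)]
  simp [mink3, diff_eq_diffL]
  ring

/-- The fourth fundamental forms of the two surfaces are proportional. -/
theorem formIVH_eq_formIVS (h : IsPolarPair X N) {p : M} (hg : N p 0 - N p 3 ≠ 0) (v w : E2) :
    formIVH X N p v w =
      ((N p 0 - N p 3) / (X p 0 - X p 3)) ^ 2 * formIVS N X p v w := by
  have hf := (h.height_pos p).ne'
  rw [h.formIVH_eq (r := (N p 0 - N p 3) / (X p 0 - X p 3)) (by field_simp),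
    h.formIVS_eq hg (q := (X p 0 - X p 3) / (N p 0 - N p 3)) (by field_simp)]
  simp only [mink, Pi.sub_apply, Pi.smul_apply, smul_eq_mul]
  field_simp
  ring

theorem gram_eq (h : IsPolarPair X N) {p : M} (hu : ¬ IsUmbilicH X N p) {ρ : ℝ}
    (hc : ∀ v w : E2, formIVH X N p v w = ρ * formIIH X N p v w) (v w : E2) :
    gram (diffL N p v) (diffL N p w) =
      ((N p 0 - N p 3) / (X p 0 - X p 3)) ^ 4 * gram (diffL X p v) (diffL X p w) := by
  have hf := (h.height_pos p).ne'
  refine gram_eq_of_conformal (h.mem p).1 (h.unit p) (h.orth p) (diffL X p) (diffL N p) (h.injX p)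
    (h.tangentX p) (h.normalX p) (h.normalN p) (h.tangentN p) (h.posX p) hu (ρ := ρ)
    (fun v w => ?_) v w
  rw [← h.formIVH_eq (by field_simp), hc]
  rfl

theorem volElt_eq (h : IsPolarPair X N) {p : M} (hu : ¬ IsUmbilicH X N p) {ρ : ℝ}
    (hc : ∀ v w : E2, formIVH X N p v w = ρ * formIIH X N p v w) (v w : E2) :
    volElt N p v w = ((N p 0 - N p 3) / (X p 3 - X p 0)) ^ 2 * volElt X p v w := by
  have e : ∀ F : M → L4, volElt F p v w = Real.sqrt (gram (diffL F p v) (diffL F p w)) :=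
    fun F => rfl
  have hpow : ∀ t : ℝ, t ^ 4 = (t ^ 2) ^ 2 := fun t => by ring
  rw [e, e, h.gram_eq hu hc, ← neg_sub (X p 0), div_neg, neg_sq, hpow, Real.sqrt_mul (by positivity), Real.sqrt_sq (by positivity)]

/-- `gram_eq` also covers `r = 0`, where it would make the metric of `N` degenerate. -/
theorem height_ne_zero (h : IsPolarPair X N) {p : M} (hu : ¬ IsUmbilicH X N p) {ρ : ℝ}
    (hc : ∀ v w : E2, formIVH X N p v w = ρ * formIIH X N p v w) : N p 0 - N p 3 ≠ 0 := by
  intro h0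
  have := gram_pos (h.posN p)
  rw [h.gram_eq hu hc, h0] at this
  simp at this

theorem continuousAt_gram {Y : E2 → L4} {U : Set E2} (hU : IsOpen U) (hY : ContDiffOn ℝ ∞ Y U)
    {u : E2} (hu : u ∈ U) (e e' : E2) :
    ContinuousAt (fun z => gram (fderiv ℝ Y z e) (fderiv ℝ Y z e')) u := by
  have h1 : ContinuousAt (fderiv ℝ Y) u :=
    (hY.continuousOn_fderiv_of_isOpen hU (by simp)).continuousAt (hU.mem_nhds hu)
  have hi : ∀ (e : E2) (i : Fin 4), ContinuousAt (fun z => fderiv ℝ Y z e i) u := fun e i =>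
    (continuous_apply i).continuousAt.comp (h1.clm_apply continuousAt_const)
  have hm : ∀ e e' : E2, ContinuousAt (fun z => mink (fderiv ℝ Y z e) (fderiv ℝ Y z e')) u :=
    fun e e' => (((((hi e 0).mul (hi e' 0)).neg).add ((hi e 1).mul (hi e' 1))).add
      ((hi e 2).mul (hi e' 2))).add ((hi e 3).mul (hi e' 3))
  exact ((hm e e).mul (hm e' e')).sub ((hm e e').pow 2)

/-- If the volume elements are related off the zero set of `N 0 - N 3`, then this set is empty. -/
theorem height_ne_zero_of_gram_eq [IsManifold 𝓘(ℝ, E2) ∞ M] (h : IsPolarPair X N)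
    (hG : ∀ p, N p 0 - N p 3 ≠ 0 → ∀ v w : E2, gram (diffL N p v) (diffL N p w) =
      ((N p 0 - N p 3) / (X p 0 - X p 3)) ^ 4 * gram (diffL X p v) (diffL X p w)) (p : M) :
    N p 0 - N p 3 ≠ 0 := by
  intro h0
  have hpos := gram_pos (h.posN p)
  have hpu : (chartAt E2 p).symm (chartAt E2 p p) = p :=
    (chartAt E2 p).left_inv (mem_chart_source E2 p)
  have hu := mem_chart_target E2 p
  have hYd := hasFDerivAt_chart h.smoothX p
  have hZd := hasFDerivAt_chart h.smoothN p
  have hYs := contDiffOn_chart h.smoothX p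
  have hZs := contDiffOn_chart h.smoothN p
  have hYf := fun u (hu : u ∈ (chartAt E2 p).target) e => fderiv_chart h.smoothX p hu e
  have hZf := fun u (hu : u ∈ (chartAt E2 p).target) e => fderiv_chart h.smoothN p hu e
  have hU := (chartAt E2 p).open_target
  set u := chartAt E2 p p
  set Y : E2 → L4 := X ∘ (chartAt E2 p).symm with hY
  set Z : E2 → L4 := N ∘ (chartAt E2 p).symm with hZ
  have hZu : Z u = N p := congrArg N hpu
  have hYi := fun i => (hasFDerivAt_pi'.1 hYd) i
  have hZi := fun i => (hasFDerivAt_pi'.1 hZd) i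
  -- The relation `hG` with denominators cleared: `D` vanishes wherever `N 0 ≠ N 3`, but is positive
  -- at a zero of `N 0 - N 3`.
  let D : E2 → ℝ := fun z => (Y z 0 - Y z 3) ^ 4 *
    gram (fderiv ℝ Z z (EuclideanSpace.single 0 1)) (fderiv ℝ Z z (EuclideanSpace.single 1 1)) -
    (Z z 0 - Z z 3) ^ 4 *
    gram (fderiv ℝ Y z (EuclideanSpace.single 0 1)) (fderiv ℝ Y z (EuclideanSpace.single 1 1))
  have hD : ContinuousAt D u :=
    ((((hYi 0).continuousAt.sub (hYi 3).continuousAt).pow 4).mul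
      (continuousAt_gram hU hZs hu _ _)).sub
    ((((hZi 0).continuousAt.sub (hZi 3).continuousAt).pow 4).mul (continuousAt_gram hU hYs hu _ _))
  have hDu : D u ≠ 0 := by
    have hYu : Y u = X p := congrArg X hpu
    simp only [D, hZu, hYu, h0, hZd.fderiv]
    have := (h.height_pos p)
    simp only [ne_eq, OfNat.ofNat_ne_zero, not_false_eq_true, zero_pow, zero_mul, sub_zero]
    positivity
  have hev : ∀ᶠ z in nhds u, Z z 0 - Z z 3 = 0 := by
    filter_upwards [hD.eventually_ne hDu, hU.mem_nhds hu] with z hz hzU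
    by_contra hne
    apply hz
    have hf := (h.height_pos ((chartAt E2 p).symm z)).ne'
    simp only [D]
    rw [hYf z hzU, hYf z hzU, hZf z hzU, hZf z hzU]
    rw [hG _ hne]
    simp only [hY, hZ, Function.comp_apply]
    field_simp
    ring
  -- `N 0 - N 3` vanishes near `p`, hence so does its differential at `p`, and `dN` takes values in
  -- the light-like hyperplane.
  have hd := ((hZi 0).sub (hZi 3)).unique
    ((hasFDerivAt_const (0 : ℝ) u).congr_of_eventuallyEq hev)
  have hdv : ∀ v, diffL N p v 0 = diffL N p v 3 := fun v =>
    sub_eq_zero.1 (congrArg (fun L : E2 →L[ℝ] ℝ => L v) hd)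
  exact hpos.ne' (gram_eq_zero_of_null (h.unit p) (sub_eq_zero.1 h0) (h.tangentN p _)
    (h.tangentN p _) (hdv _) (hdv _))

theorem contMDiff_height {F : M → L4} (hF : ContMDiff 𝓘(ℝ, E2) 𝓘(ℝ, L4) ∞ F) :
    ContMDiff 𝓘(ℝ, E2) 𝓘(ℝ, ℝ) ∞ fun p => F p 0 - F p 3 := by
  have hi := contMDiff_pi_space.1 hF
  exact (hi 0).sub (hi 3)

theorem conformalS_of_conformalH (h : IsPolarPair X N) (hu : ∀ p, ¬ IsUmbilicH X N p)
    (hc : ConformalGaussH X N) : ConformalGaussS N X := by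
  obtain ⟨ρ, hρ, hc⟩ := hc
  have hg := fun p => h.height_ne_zero (hu p) (hc p)
  -- The factor follows from `IV_X = r² IV_N` and `II_X = -II_N`; it is smooth because `N 0 - N 3`
  -- has no zeros.
  refine ⟨fun p => -(((X p 0 - X p 3) / (N p 0 - N p 3)) ^ 2 * ρ p), ContMDiff.contMDiffOn
    (((((contMDiff_height h.smoothX).div₀ (contMDiff_height h.smoothN) hg).pow 2).mul hρ).neg),
    fun p _ v w => ?_⟩
  -- The arguments are swapped because `II_X(w, v) = -II_N(v, w)` holds by definition; only the
  -- symmetry of `IV` is then needed.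
  have e1 := h.formIVH_eq_formIVS (hg p) w v
  have e2 := hc p w v
  have hII : formIIH X N p w v = -formIIS N X p v w := by
    simp only [formIIH, formIIS, mink_comm]
  have hsymm : formIVS N X p w v = formIVS N X p v w := by
    simp only [formIVS, mink3]; ring
  have hf := (h.height_pos p).ne'
  have hgp := hg p
  have e3 : ((N p 0 - N p 3) / (X p 0 - X p 3)) ^ 2 * formIVS N X p v w =
      -(ρ p * formIIS N X p v w) := by
    rw [← hsymm, ← e1, e2, hII]; ring
  field_simp at e3 ⊢
  linarith

theorem conformalH_of_conformalS [IsManifold 𝓘(ℝ, E2) ∞ M] (h : IsPolarPair X N)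
    (hu : ∀ p, ¬ IsUmbilicH X N p) (hc : ConformalGaussS N X) : ConformalGaussH X N := by
  obtain ⟨ρ, hρ, hc⟩ := hc
  have hmem : ∀ p, N p 0 - N p 3 ≠ 0 → p ∈ gaussDomain N := fun p hp => lt_or_gt_of_ne hp
  have hIV : ∀ p, N p 0 - N p 3 ≠ 0 → ∀ v w : E2, formIVH X N p v w =
      -(((N p 0 - N p 3) / (X p 0 - X p 3)) ^ 2 * ρ p) * formIIH X N p v w := by
    intro p hp v w
    have hII : formIIH X N p v w = -formIIS N X p w v := by
      simp only [formIIH, formIIS, mink_comm]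
    have hsymm : formIVS N X p v w = formIVS N X p w v := by
      simp only [formIVS, mink3]; ring
    linear_combination h.formIVH_eq_formIVS hp v w +
      ((N p 0 - N p 3) / (X p 0 - X p 3)) ^ 2 * (hsymm + hc p (hmem p hp) w v + ρ p * hII)
  have hg := h.height_ne_zero_of_gram_eq fun p hp => h.gram_eq (hu p) (hIV p hp)
  have huniv : gaussDomain N = Set.univ := Set.eq_univ_of_forall fun p => hmem p (hg p)
  rw [huniv, contMDiffOn_univ] at hρ
  exact ⟨_, ((((contMDiff_height h.smoothN).div₀ (contMDiff_height h.smoothX)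
    fun p => (h.height_pos p).ne').pow 2).mul hρ).neg, fun p => hIV p (hg p)⟩

end IsPolarPair

end PolarDuality

open PolarDuality in
theorem theorem4p2 {M : Type*} [TopologicalSpace M] [ConnectedSpace M] [ChartedSpace E2 M]
    [IsManifold 𝓘(ℝ, E2) ∞ M] (X N : M → L4)
    (hX : IsSurfaceH X) (hN : IsSpacelikeSurfaceS N)
    (hXN : IsGenGaussMapH X N) (hNX : IsGenGaussMapS N X)
    (hXu : ∀ p, ¬ IsUmbilicH X N p) (hXK : ∀ p, gaussCurvature X p ≠ -1)
    (hNu : ∀ p, ¬ IsUmbilicS N X p) (hNK : ∀ p, gaussCurvature N p ≠ 1) :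
    (ConformalGaussH X N ↔ ConformalGaussS N X) ∧
      (ConformalGaussH X N →
        ∀ (p : M) (v w : TangentSpace 𝓘(ℝ, E2) p),
          volElt N p v w = ((N p 0 - N p 3) / (X p 3 - X p 0)) ^ 2 * volElt X p v w) := by
  have h : IsPolarPair X N :=
    { smoothX := hX.smooth
      smoothN := hN.smooth
      mem := hX.mem
      unit := hN.mem
      orth := hXN.tangent
      injX := hX.immersed
      normalX := hXN.normal
      normalN := hNX.normal
      posN := hN.spacelike }
  refine ⟨⟨h.conformalS_of_conformalH hXu, h.conformalH_of_conformalS hXu⟩, ?_⟩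
  rintro ⟨ρ, -, hρ⟩ p v w
  exact h.volElt_eq (hXu p) (hρ p) v w
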